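/- For $n\ge 1$ and a labeled simple graph $G$ on $n$ nodes let $t(G)=\big(|\mathrm{hom}(K_2,G)|/n^2,\ |\mathrm{hom}(K_3,G)|/n^3\big)\in\mathbb R^2$ be the vector of its edge and triangle homomorphism densities, and for $x\in\mathbb R^2$ let $\nu_n(x)$ be the number of labeled simple graphs $G$ on $n$ nodes with $t(G)=x$. For $k\ge 0$ let $v_k=\big(\tfrac{k}{k+1},\tfrac{k(k-1)}{(k+1)^2}\big)$, and let $l_k=(v_{k+1}-v_k)/\|v_{k+1}-v_k\|$, the unit vector that is a positive multiple of $\big(1,\tfrac{k(3k+5)}{(k+1)(k+2)}\big)$. For $\beta\in\mathbb R^2$ and $x\in\{v_k,v_{k+1}\}$ put $$\mathbb P_{n,k,\beta}(x)=\frac{e^{n^2\langle x,\beta\rangle}\,\nu_n(x)}{e^{n^2\langle v_k,\beta\rangle}\nu_n(v_k)+e^{n^2\langle v_{k+1},\beta\rangle}\nu_n(v_{k+1})}.$$ Fix an integer $k\ge 1$ and $\beta\in\mathbb R^2$, let $n_j=j(k+1)(k+2)$ for $j=1,2,\dots$, and let $$\rho_j=\frac{\mathbb P_{n_j,k,\beta}(v_{k+1})}{\mathbb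 P_{n_j,k,\beta}(v_k)},\qquad C_k(\beta)=\langle l_k,\beta\rangle\,\langle v_{k+1}-v_k,l_k\rangle .$$ Then: (1) as $j\to\infty$, $\rho_j\to\infty$ if $\langle l_k,\beta\rangle\ge 0$, and $\rho_j\to 0$ if $\langle l_k,\beta\rangle<0$; (2) $\langle v_{k+1}-v_k,l_k\rangle>0$, so that $C_k(\beta)$ has the sign of $\langle l_k,\beta\rangle$, and as $j\to\infty$ $$\frac{\log\rho_j}{n_j^2}\to C_k(\beta),\qquad \rho_j\asymp e^{n_j^2C_k(\beta)}\,\frac1{\sqrt{n_j}}\Big(\frac{k+2}{k+1}\Big)^{n_j};$$ thus the growth or decay is exponential in $n_j^2$ when $\langle l_k,\beta\rangle\neq0$; (3) for every $j\ge1$, $\nu_{n_j}(v_k)$ and $\nu_{n_j}(v_{k+1})$ are the numbers of labeled graphs on $n_j$ nodes isomorphic to the Turán graph with $k+1$, respectively $k+2$, classes, so that $$\nu_{n_j}(v_k)=\frac{n_j!}{(k+1)!\,[(j(k+2))!]^{k+1}},\qquad \nu_{n_j}(v_{k+1})=\frac{n_j!}{(k+2)!\,[(j(k+1))!]^{k+2}},$$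 and, as $j\to\infty$, $$\frac{\nu_{n_j}(v_{k+1})}{\nu_{n_j}(v_k)}\asymp\frac1{\sqrt{n_j}}\Big(\frac{k+2}{k+1}\Big)^{n_j}.$$ Here $a_j\asymp b_j$ means that $a_j/b_j$ is bounded between two positive constants for all large $j$. -/

import Mathlib

open Filter Topology Asymptotics

namespace EdgeTriangle

noncomputable section

/-- Homomorphism density `t(H, G) = |hom(H, G)| / |V(G)| ^ |V(H)|`. -/
def homDensity {m n : ℕ} (H : SimpleGraph (Fin m)) (G : SimpleGraph (Fin n)) : ℝ :=
  (Nat.card (H →g G) : ℝ) / (n : ℝ) ^ m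

/-- The vector of edge and triangle homomorphism densities of a labeled graph on `n` nodes. -/
def density {n : ℕ} (G : SimpleGraph (Fin n)) : EuclideanSpace ℝ (Fin 2) :=
  !₂[homDensity (⊤ : SimpleGraph (Fin 2)) G, homDensity (⊤ : SimpleGraph (Fin 3)) G]

/-- `ν_n(x)`: the number of labeled simple graphs on `n` nodes with density vector `x`. -/
def nu (n : ℕ) (x : EuclideanSpace ℝ (Fin 2)) : ℕ :=
  Nat.card {G : SimpleGraph (Fin n) // density G = x}

/-- The number of labeled graphs on `n` nodes isomorphic to the Turán graph with `r` classes. -/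
def turanCount (n r : ℕ) : ℕ :=
  Nat.card {G : SimpleGraph (Fin n) // Nonempty (G ≃g SimpleGraph.turanGraph n r)}

/-- The vertex `v_k = (k/(k+1), k(k-1)/(k+1)²)`, the edge and triangle densities of the Turán
graphon with `k + 1` classes. -/
def vertex (k : ℕ) : EuclideanSpace ℝ (Fin 2) :=
  !₂[(k : ℝ) / (k + 1), (k : ℝ) * (k - 1) / (k + 1) ^ 2]

/-- The unit vector `l_k` parallel to the segment from `v_k` to `v_{k+1}`; it is a positive
multiple of `(1, k(3k+5)/((k+1)(k+2)))`. -/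
def unitDir (k : ℕ) : EuclideanSpace ℝ (Fin 2) :=
  ‖vertex (k + 1) - vertex k‖⁻¹ • (vertex (k + 1) - vertex k)

open Classical in
/-- The two-point exponential family `P_{n,k,β}` supported on `{v_k, v_{k+1}}`, with base
measure `ν_n`. -/
def twoPointProb (n k : ℕ) (β x : EuclideanSpace ℝ (Fin 2)) : ℝ :=
  if x = vertex k ∨ x = vertex (k + 1) then
    Real.exp ((n : ℝ) ^ 2 * inner ℝ x β) * (nu n x : ℝ) /
      (Real.exp ((n : ℝ) ^ 2 * inner ℝ (vertex k) β) * (nu n (vertex k) : ℝ) +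
        Real.exp ((n : ℝ) ^ 2 * inner ℝ (vertex (k + 1)) β) * (nu n (vertex (k + 1)) : ℝ))
  else 0

/-- The subsequence `n_j = j (k+1) (k+2)`. -/
def nSeq (k j : ℕ) : ℕ := j * (k + 1) * (k + 2)

/-- The ratio `P_{n_j,k,β}(v_{k+1}) / P_{n_j,k,β}(v_k)`. -/
def probRatio (k : ℕ) (β : EuclideanSpace ℝ (Fin 2)) (j : ℕ) : ℝ :=
  twoPointProb (nSeq k j) k β (vertex (k + 1)) / twoPointProb (nSeq k j) k β (vertex k)

/-- The rate constant `C_k(β) = ⟨l_k, β⟩ ⟨v_{k+1} - v_k, l_k⟩`. -/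
def rate (k : ℕ) (β : EuclideanSpace ℝ (Fin 2)) : ℝ :=
  inner ℝ (unitDir k) β * inner ℝ (vertex (k + 1) - vertex k) (unitDir k)

end

end EdgeTriangle

/-!
Write `n = (k + 1) m` and `d = k m`. A graph on `n` nodes has edge density that of `v_k` iff its
average degree is `d`, and then inclusion–exclusion over the ends of each oriented edge gives
`hom(K₃, G) = n d (2 d - n) + 2 ∑ (deg v - d)² + #{(oriented edge, vertex adjacent to neither end)}`.
The triangle density is that of `v_k` iff both corrections vanish: the graph is regular and
non-adjacency is transitive, so it is the balanced complete `(k + 1)`-partite graph. By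
orbit–stabilizer the labeled copies number `n! / ((k + 1)! m! ^ (k + 1))`, and Stirling's formula
gives the ratio of the counts at `v_{k+1}` and `v_k`. Its logarithm is only `O(n)`, so the Gibbs
weight `exp (n² C_k(β))` decides the limit, except when `C_k(β) = 0`, where the ratio of the counts
itself diverges.
-/

namespace EdgeTriangle

open Finset Real SimpleGraph
open scoped Nat

section LabeledGraphs

variable {V W : Type*}

/-- A labeled copy of `H` together with an isomorphism to `H` is a relabeling of the vertices. -/
def sigmaIsoEquiv (H : SimpleGraph W) :
    (Σ G : {G : SimpleGraph V // Nonempty (G ≃g H)}, G.1 ≃g H) ≃ (V ≃ W) where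
  toFun p := p.2.toEquiv
  invFun e := ⟨⟨H.comap e, ⟨Iso.comap e H⟩⟩, Iso.comap e H⟩
  left_inv := by
    rintro ⟨⟨G, hG⟩, e, he⟩
    obtain rfl : H.comap e = G := by
      ext u v
      exact he
    rfl
  right_inv _ := rfl

theorem card_isomorphic_mul_card_aut (H : SimpleGraph W) :
    Nat.card {G : SimpleGraph V // Nonempty (G ≃g H)} * Nat.card (H ≃g H) = Nat.card (V ≃ W) := by
  rw [← Nat.card_prod, ← Nat.card_congr (sigmaIsoEquiv H)]
  exact Nat.card_congr ((Equiv.sigmaEquivProdOfEquiv fun G =>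
    RelIso.relIsoCongr G.2.some (RelIso.refl _)).symm)

end LabeledGraphs

section Equipartite

variable {r m : ℕ}

/-- The automorphism of the complete equipartite graph permuting the classes by `e.1` and sending
the `i`-th class to its image by `e.2 i`. -/
def equipartiteAut (e : Equiv.Perm (Fin r) × (Fin r → Equiv.Perm (Fin m))) :
    completeEquipartiteGraph r m ≃g completeEquipartiteGraph r m where
  toEquiv := Equiv.prodShear e.1 e.2
  map_rel_iff' := by simp

theorem equipartiteAut_injective (hm : m ≠ 0) :
    Function.Injective (equipartiteAut (r := r) (m := m)) := by
  have : NeZero m := ⟨hm⟩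
  intro e e' h
  have h_apply (p : Fin r × Fin m) : (e.1 p.1, e.2 p.1 p.2) = (e'.1 p.1, e'.2 p.1 p.2) :=
    DFunLike.congr_fun h p
  exact Prod.ext (Equiv.ext fun i => congrArg Prod.fst (h_apply (i, 0)))
    (funext fun i => Equiv.ext fun a => congrArg Prod.snd (h_apply (i, a)))

theorem equipartiteAut_surjective (hm : m ≠ 0) :
    Function.Surjective (equipartiteAut (r := r) (m := m)) := by
  have : NeZero m := ⟨hm⟩
  intro e
  have h_class (p q : Fin r × Fin m) : (e p).1 = (e q).1 ↔ p.1 = q.1 :=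
    not_iff_not.1 e.map_adj_iff
  have hτ : Function.Injective fun i => (e (i, 0)).1 := fun i i' h => (h_class _ _).1 h
  have hg (i : Fin r) : Function.Injective fun a => (e (i, a)).2 := fun a a' h =>
    congrArg Prod.snd (e.injective (Prod.ext ((h_class (i, a) (i, a')).2 rfl) h))
  refine ⟨⟨Equiv.ofBijective _ hτ.bijective_of_finite,
    fun i => Equiv.ofBijective _ (hg i).bijective_of_finite⟩, RelIso.ext fun p => ?_⟩
  exact Prod.ext ((h_class (p.1, 0) p).2 rfl) rfl

theorem card_aut_completeEquipartiteGraph (hm : m ≠ 0) :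
    Nat.card (completeEquipartiteGraph r m ≃g completeEquipartiteGraph r m) = r ! * m ! ^ r := by
  rw [← Nat.card_congr
    (Equiv.ofBijective _ ⟨equipartiteAut_injective hm, equipartiteAut_surjective hm⟩)]
  simp only [Nat.card_prod, Nat.card_pi, Nat.card_perm, Nat.card_fin, prod_const, card_univ,
    Fintype.card_fin]

theorem turanCount_mul (hm : m ≠ 0) : turanCount (r * m) r * (r ! * m ! ^ r) = (r * m)! := by
  have h_aut : Nat.card (turanGraph (r * m) r ≃g turanGraph (r * m) r) = r ! * m ! ^ r := by
    rw [← card_aut_completeEquipartiteGraph hm]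
    exact Nat.card_congr (RelIso.relIsoCongr completeEquipartiteGraph.turanGraph
      completeEquipartiteGraph.turanGraph).symm
  rw [← h_aut, turanCount, card_isomorphic_mul_card_aut, Nat.card_perm, Nat.card_fin]

theorem turanCount_pos (hm : m ≠ 0) : 0 < turanCount (r * m) r :=
  Nat.pos_of_mul_pos_right (turanCount_mul hm ▸ Nat.factorial_pos _)

theorem turanCount_eq_div (hm : m ≠ 0) :
    (turanCount (r * m) r : ℝ) = (r * m)! / (r ! * (m ! : ℝ) ^ r) := by
  rw [eq_div_iff (by positivity)]
  exact_mod_cast turanCount_mul hm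

end Equipartite

section Goodman

theorem sum_sq_eq_card_mul_sq_add_sum_sub_sq {ι R : Type*} [Fintype ι] [CommRing R] {f : ι → R}
    {d : R} (h : ∑ i, f i = Fintype.card ι * d) :
    ∑ i, f i ^ 2 = Fintype.card ι * d ^ 2 + ∑ i, (f i - d) ^ 2 := by
  simp only [sub_sq, sum_add_distrib, sum_sub_distrib, ← sum_mul, ← mul_sum, h, sum_const,
    card_univ, nsmul_eq_mul]
  ring

variable {V : Type*} (G : SimpleGraph V)

/-- A homomorphism from `K₂` is an oriented edge. -/
def homTopTwoEquiv : ((⊤ : SimpleGraph (Fin 2)) →g G) ≃ G.Dart where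
  toFun f := ⟨(f 0, f 1), f.map_adj (by simp)⟩
  invFun d := ⟨![d.fst, d.snd], fun {a b} hab => by
    have h := d.adj
    have h' := h.symm
    fin_cases a <;> fin_cases b <;> simp_all⟩
  left_inv f := by
    ext i
    fin_cases i <;> rfl
  right_inv d := rfl

/-- A homomorphism from `K₃` is an oriented edge together with a common neighbor of its ends. -/
def homTopThreeEquiv :
    ((⊤ : SimpleGraph (Fin 3)) →g G) ≃ Σ d : G.Dart, G.commonNeighbors d.fst d.snd where
  toFun f := ⟨⟨(f 0, f 1), f.map_adj (by simp)⟩,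
    ⟨f 2, f.map_adj (by simp), f.map_adj (by simp)⟩⟩
  invFun p := ⟨![p.1.fst, p.1.snd, p.2], fun {a b} hab => by
    have h := p.1.adj
    obtain ⟨h₀, h₁⟩ := p.2.2
    rw [mem_neighborSet] at h₀ h₁
    have h' := h.symm
    have h₀' := h₀.symm
    have h₁' := h₁.symm
    fin_cases a <;> fin_cases b <;> simp_all⟩
  left_inv f := by
    ext i
    fin_cases i <;> rfl
  right_inv p := rfl

variable [Fintype V] [DecidableRel G.Adj]

theorem sum_dart_fst {M : Type*} [AddCommMonoid M] (f : V → M) :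
    ∑ d : G.Dart, f d.fst = ∑ v, G.degree v • f v := by
  classical
  rw [← sum_fiberwise univ (fun d : G.Dart => d.fst)]
  refine sum_congr rfl fun v _ => ?_
  rw [← G.dart_fst_fiber_card_eq_degree v, ← sum_const]
  exact sum_congr rfl fun d hd => by rw [(mem_filter.1 hd).2]

theorem sum_dart_snd {M : Type*} [AddCommMonoid M] (f : V → M) :
    ∑ d : G.Dart, f d.snd = ∑ v, G.degree v • f v := by
  rw [← sum_dart_fst]
  exact Equiv.sum_comp Dart.symm_involutive.toPerm fun d : G.Dart => f d.fst

theorem card_hom_top_two : Nat.card ((⊤ : SimpleGraph (Fin 2)) →g G) = ∑ v, G.degree v := by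
  rw [Nat.card_congr (homTopTwoEquiv G), Nat.card_eq_fintype_card, dart_card_eq_sum_degrees]

theorem card_hom_top_three [DecidableEq V] : Nat.card ((⊤ : SimpleGraph (Fin 3)) →g G) =
    ∑ d : G.Dart, #(G.neighborFinset d.fst ∩ G.neighborFinset d.snd) := by
  rw [Nat.card_congr (homTopThreeEquiv G), Nat.card_sigma]
  refine sum_congr rfl fun d _ => ?_
  rw [Nat.card_eq_fintype_card, ← Set.toFinset_card]
  congr 1
  ext w
  simp only [Set.mem_toFinset, mem_commonNeighbors, mem_inter, mem_neighborFinset]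

theorem card_hom_top_three_add [DecidableEq V] : Nat.card ((⊤ : SimpleGraph (Fin 3)) →g G) +
      Fintype.card V * ∑ v, G.degree v =
    2 * ∑ v, G.degree v ^ 2 +
      ∑ d : G.Dart, #(G.neighborFinset d.fst ∪ G.neighborFinset d.snd)ᶜ := by
  have h_dart (d : G.Dart) :
      #(G.neighborFinset d.fst ∩ G.neighborFinset d.snd) + Fintype.card V =
        G.degree d.fst + G.degree d.snd +
          #(G.neighborFinset d.fst ∪ G.neighborFinset d.snd)ᶜ := by
    have h_union := card_union_add_card_inter (G.neighborFinset d.fst) (G.neighborFinset d.snd)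
    have h_compl := card_add_card_compl (G.neighborFinset d.fst ∪ G.neighborFinset d.snd)
    rw [card_neighborFinset_eq_degree, card_neighborFinset_eq_degree] at h_union
    omega
  calc _ = ∑ d : G.Dart,
        (#(G.neighborFinset d.fst ∩ G.neighborFinset d.snd) + Fintype.card V) := by
        rw [sum_add_distrib, card_hom_top_three, sum_const, card_univ, dart_card_eq_sum_degrees,
          smul_eq_mul, mul_comm]
    _ = _ := by
        simp only [h_dart, sum_add_distrib, sum_dart_fst G fun v => G.degree v,
          sum_dart_snd G fun v => G.degree v, sq,
          two_mul, smul_eq_mul]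

theorem sum_card_compl_union_neighborFinset_eq_zero_iff [DecidableEq V] :
    ∑ d : G.Dart, #(G.neighborFinset d.fst ∪ G.neighborFinset d.snd)ᶜ = 0 ↔
      G.IsCompleteMultipartite := by
  simp only [sum_eq_zero_iff, mem_univ, true_imp_iff, card_eq_zero, eq_empty_iff_forall_notMem,
    mem_compl, mem_union, mem_neighborFinset, not_not]
  refine ⟨fun h => ⟨fun u w v huw hwv huv => ?_⟩, fun h d w => ?_⟩
  · exact (h ⟨(u, v), huv⟩ w).elim huw fun hvw => hwv hvw.symm
  · by_contra! hw
    exact h.trans _ _ _ hw.1 (fun hwd => hw.2 hwd.symm) d.adj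

theorem card_hom_top_three_eq [DecidableEq V] {d : ℕ} (hd : ∑ v, G.degree v = Fintype.card V * d) :
    (Nat.card ((⊤ : SimpleGraph (Fin 3)) →g G) : ℤ) =
      Fintype.card V * d * (2 * d - Fintype.card V) + (2 * ∑ v, ((G.degree v : ℤ) - d) ^ 2 +
        ∑ d : G.Dart, (#(G.neighborFinset d.fst ∪ G.neighborFinset d.snd)ᶜ : ℤ)) := by
  have h_sq := sum_sq_eq_card_mul_sq_add_sum_sub_sq (f := fun v => (G.degree v : ℤ)) (d := (d : ℤ))
    (by exact_mod_cast hd)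
  have h_card := congrArg (Nat.cast : ℕ → ℤ) (card_hom_top_three_add G)
  rw [hd] at h_card
  push_cast at h_card
  linear_combination h_card + 2 * h_sq

theorem goodman_equality_iff (d : ℕ) :
    (∑ v, G.degree v = Fintype.card V * d ∧
      (Nat.card ((⊤ : SimpleGraph (Fin 3)) →g G) : ℤ) =
        Fintype.card V * d * (2 * d - Fintype.card V)) ↔
      G.IsRegularOfDegree d ∧ G.IsCompleteMultipartite := by
  classical
  have h_avg (h : G.IsRegularOfDegree d) : ∑ v, G.degree v = Fintype.card V * d := by
    simp only [h.degree_eq, sum_const, card_univ, smul_eq_mul]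
  have h_var : ∑ v, ((G.degree v : ℤ) - d) ^ 2 = 0 ↔ G.IsRegularOfDegree d := by
    rw [sum_eq_zero_iff_of_nonneg fun _ _ => sq_nonneg _]
    simp only [mem_univ, true_imp_iff, sq_eq_zero_iff, sub_eq_zero, Nat.cast_inj,
      IsRegularOfDegree]
  rw [← and_iff_right_of_imp (a := ∑ v, G.degree v = Fintype.card V * d)
    fun h : G.IsRegularOfDegree d ∧ G.IsCompleteMultipartite => h_avg h.1]
  refine and_congr_right fun hd => ?_
  rw [card_hom_top_three_eq G hd, add_eq_left, add_eq_zero_iff_of_nonneg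
    (mul_nonneg zero_le_two (sum_nonneg fun _ _ => sq_nonneg _))
    (sum_nonneg fun _ _ => Nat.cast_nonneg _), mul_eq_zero_iff_left two_ne_zero, h_var,
    ← sum_card_compl_union_neighborFinset_eq_zero_iff]
  norm_cast

end Goodman

section Balanced

/-- A complete multipartite graph with `r` classes of size `m` is complete equipartite. -/
def completeMultipartiteIso {ι : Type*} {X : ι → Type*} {r m : ℕ} (e : ι ≃ Fin r)
    (f : ∀ i, X i ≃ Fin m) : completeMultipartiteGraph X ≃g completeEquipartiteGraph r m where
  toEquiv := (Equiv.sigmaCongr e f).trans (Equiv.sigmaEquivProd _ _)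
  map_rel_iff' := not_congr e.injective.eq_iff

variable {V : Type*} [Fintype V] {G : SimpleGraph V} [DecidableRel G.Adj] {k m : ℕ}

theorem card_not_adj_of_isRegularOfDegree (hV : Fintype.card V = (k + 1) * m)
    (hG : G.IsRegularOfDegree (k * m)) (v : V) : Nat.card {w // ¬ G.Adj v w} = m := by
  classical
  have h_compl := card_add_card_compl (G.neighborFinset v)
  rw [card_neighborFinset_eq_degree, hG.degree_eq, hV, add_one_mul] at h_compl
  rw [Nat.card_eq_fintype_card, Fintype.card_subtype, ← Nat.add_left_cancel h_compl]
  congr 1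
  ext w
  simp only [mem_filter, mem_univ, true_and, mem_compl, mem_neighborFinset]

theorem nonempty_iso_completeEquipartiteGraph (hm : m ≠ 0) (hV : Fintype.card V = (k + 1) * m)
    (h_reg : G.IsRegularOfDegree (k * m)) (h_mult : G.IsCompleteMultipartite) :
    Nonempty (G ≃g completeEquipartiteGraph (k + 1) m) := by
  classical
  have h_class (c : Quotient h_mult.setoid) :
      Nat.card {x // h_mult.setoid.r c.out x} = m :=
    card_not_adj_of_isRegularOfDegree hV h_reg c.out
  have h_classes : Nat.card (Quotient h_mult.setoid) = k + 1 := by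
    refine Nat.eq_of_mul_eq_mul_right (Nat.pos_of_ne_zero hm) ?_
    rw [← hV, ← Nat.card_eq_fintype_card, Nat.card_congr h_mult.iso.toEquiv, Nat.card_sigma]
    simp only [h_class, sum_const, card_univ, Nat.card_eq_fintype_card, smul_eq_mul]
  exact ⟨h_mult.iso.trans (completeMultipartiteIso (Finite.equivFinOfCardEq h_classes)
    fun c => Finite.equivFinOfCardEq (h_class c))⟩

theorem nonempty_iso_completeEquipartiteGraph_iff (hm : m ≠ 0)
    (hV : Fintype.card V = (k + 1) * m) :
    Nonempty (G ≃g completeEquipartiteGraph (k + 1) m) ↔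
      G.IsRegularOfDegree (k * m) ∧ G.IsCompleteMultipartite := by
  refine ⟨fun ⟨e⟩ => ⟨fun v => ?_, ⟨fun u v w => ?_⟩⟩, fun h =>
    nonempty_iso_completeEquipartiteGraph hm hV h.1 h.2⟩
  · rw [← e.degree_eq, degree_completeEquipartiteGraph, Nat.add_sub_cancel]
  · simp only [← e.map_adj_iff]
    exact completeEquipartiteGraph.isCompleteMultipartite.trans _ _ _

end Balanced

section Densities

variable {k m n : ℕ}

theorem density_eq_vertex_iff {G : SimpleGraph (Fin n)} :
    density G = vertex k ↔ homDensity (⊤ : SimpleGraph (Fin 2)) G = k / (k + 1) ∧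
      homDensity (⊤ : SimpleGraph (Fin 3)) G = k * (k - 1) / (k + 1) ^ 2 := by
  simp only [PiLp.ext_iff, Fin.forall_fin_two, density, vertex]
  rfl

theorem density_eq_vertex_iff_nonempty_iso (hm : m ≠ 0) (G : SimpleGraph (Fin ((k + 1) * m))) :
    density G = vertex k ↔ Nonempty (G ≃g turanGraph ((k + 1) * m) (k + 1)) := by
  classical
  have h_turan : Nonempty (G ≃g turanGraph ((k + 1) * m) (k + 1)) ↔
      Nonempty (G ≃g completeEquipartiteGraph (k + 1) m) :=
    (RelIso.relIsoCongr (RelIso.refl _) completeEquipartiteGraph.turanGraph).symm.nonempty_congr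
  rw [h_turan, nonempty_iso_completeEquipartiteGraph_iff hm (Fintype.card_fin _),
    ← goodman_equality_iff, ← card_hom_top_two, Fintype.card_fin, density_eq_vertex_iff,
    homDensity, homDensity, div_eq_iff (by positivity), div_eq_iff (by positivity),
    ← Nat.cast_inj (R := ℝ), ← Int.cast_inj (α := ℝ)]
  push_cast
  refine and_congr (Eq.congr_right ?_) (Eq.congr_right ?_)
  · field_simp
  · field_simp
    ring

theorem nu_vertex (hm : m ≠ 0) :
    nu ((k + 1) * m) (vertex k) = turanCount ((k + 1) * m) (k + 1) := by
  simp only [nu, turanCount, density_eq_vertex_iff_nonempty_iso hm]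

end Densities

section Asymptotics

theorem isBigO_log_sub_log {α : Type*} {l : Filter α} {f g : α → ℝ} (h : f =Θ[l] g) :
    (fun x => log (f x) - log (g x)) =O[l] fun _ => (1 : ℝ) := by
  obtain ⟨C, hC, hfg⟩ := h.1.exists_pos
  obtain ⟨D, hD, hgf⟩ := h.2.exists_pos
  refine .of_bound (|log C| + |log D|) ?_
  filter_upwards [hfg.bound, hgf.bound] with x hfx hgx
  rw [norm_one, mul_one, norm_eq_abs]
  rcases eq_or_ne (g x) 0 with hg | hg
  · have hf : f x = 0 := norm_le_zero_iff.1 (by simpa only [hg, norm_zero, mul_zero] using hfx)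
    rw [hf, hg, sub_self, abs_zero]
    positivity
  have hf : f x ≠ 0 := fun hf => hg <|
    norm_le_zero_iff.1 (by simpa only [hf, norm_zero, mul_zero] using hgx)
  have h_upper := log_le_log (norm_pos_iff.2 hf) hfx
  have h_lower := log_le_log (norm_pos_iff.2 hg) hgx
  rw [log_mul hC.ne' (norm_ne_zero_iff.2 hg)] at h_upper
  rw [log_mul hD.ne' (norm_ne_zero_iff.2 hf)] at h_lower
  simp only [norm_eq_abs, log_abs] at h_upper h_lower
  rw [abs_le]
  constructor <;> linarith [le_abs_self (log C), le_abs_self (log D), abs_nonneg (log C),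
    abs_nonneg (log D)]

theorem tendsto_log_div_of_isTheta {α : Type*} {l : Filter α} {f g c : α → ℝ} {L : ℝ}
    (h : f =Θ[l] g) (hc : Tendsto c l atTop)
    (hg : Tendsto (fun x => log (g x) / c x) l (𝓝 L)) :
    Tendsto (fun x => log (f x) / c x) l (𝓝 L) := by
  have h_one : (fun _ => (1 : ℝ)) =o[l] c :=
    isLittleO_const_left.2 (.inr (tendsto_norm_atTop_atTop.comp hc))
  have h_sub := ((isBigO_log_sub_log h).trans_isLittleO h_one).tendsto_div_nhds_zero
  refine (add_zero L ▸ hg.add h_sub).congr fun x => ?_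
  ring

theorem tendsto_zero_of_tendsto_log_div {α : Type*} {l : Filter α} {f c : α → ℝ} {L : ℝ}
    (hL : L < 0) (hc : Tendsto c l atTop)
    (hf : Tendsto (fun x => log (f x) / c x) l (𝓝 L)) : Tendsto f l (𝓝 0) := by
  have h_exp := tendsto_exp_atBot.comp (hf.neg_mul_atTop hL hc)
  refine squeeze_zero_norm' ?_ h_exp
  filter_upwards [hc.eventually_ne_atTop 0] with x hx
  rw [Function.comp_apply, div_mul_cancel₀ _ hx, norm_eq_abs, ← log_abs]
  exact le_exp_log _

theorem tendsto_log_exp_sq_mul_sqrt_mul_pow (c : ℝ) {q : ℝ} (hq : q ≠ 0) :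
    Tendsto (fun n : ℕ => log (exp ((n : ℝ) ^ 2 * c) * √(1 / (n : ℝ)) * q ^ n) / (n : ℝ) ^ 2)
      atTop (𝓝 c) := by
  have h_log : Tendsto (fun n : ℕ => log n / n) atTop (𝓝 0) :=
    isLittleO_log_id_atTop.tendsto_div_nhds_zero.comp tendsto_natCast_atTop_atTop
  have h_lim := (((h_log.div_const 2).const_sub (log q)).mul
    tendsto_inv_atTop_nhds_zero_nat).const_add c
  rw [mul_zero, add_zero] at h_lim
  refine h_lim.congr' ?_
  filter_upwards [eventually_gt_atTop 0] with n hn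
  rw [log_mul (by positivity) (pow_ne_zero n hq), log_mul (exp_ne_zero _) (by positivity),
    log_exp, log_pow, log_sqrt (by positivity), one_div, log_inv]
  field_simp
  ring

theorem tendsto_exp_sq_mul_sqrt_mul_pow_atTop {c q : ℝ} (hc : 0 ≤ c) (hq : 1 < q) :
    Tendsto (fun n : ℕ => exp ((n : ℝ) ^ 2 * c) * √(1 / (n : ℝ)) * q ^ n) atTop atTop := by
  have h_pow := (tendsto_exp_mul_div_rpow_atTop (1 / 2) _ (log_pos hq)).comp
    tendsto_natCast_atTop_atTop
  refine tendsto_atTop_mono (fun n => ?_) h_pow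
  have h_eq : exp (log q * n) / (n : ℝ) ^ (1 / 2 : ℝ) = √(1 / (n : ℝ)) * q ^ n := by
    rw [← sqrt_eq_rpow, mul_comm (log q), ← log_pow, exp_log (by positivity), one_div, sqrt_inv,
      div_eq_inv_mul]
  rw [Function.comp_apply, h_eq, mul_assoc]
  exact le_mul_of_one_le_left (by positivity) (one_le_exp (by positivity))

theorem factorial_mul_pow_isTheta {a : ℕ} (ha : a ≠ 0) (b : ℕ) :
    (fun j : ℕ => ((j * a)! : ℝ) ^ b) =Θ[atTop]
      fun j : ℕ => √(j : ℝ) ^ b * (j * a / exp 1) ^ (j * a * b) := by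
  have h_atTop : Tendsto (fun j : ℕ => j * a) atTop atTop :=
    tendsto_id.atTop_mul_const' (Nat.pos_of_ne_zero ha)
  have h_const : √(2 * a * π) ^ b ≠ 0 := by positivity
  calc (fun j : ℕ => ((j * a)! : ℝ) ^ b)
    _ =Θ[atTop] fun j : ℕ => (√(2 * (j * a : ℕ) * π) * ((j * a : ℕ) / exp 1) ^ (j * a)) ^ b :=
        (Stirling.factorial_isEquivalent_stirling.comp_tendsto h_atTop).isTheta.pow b
    _ = fun j : ℕ => √(2 * a * π) ^ b * (√(j : ℝ) ^ b * (j * a / exp 1) ^ (j * a * b)) := by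
        funext j
        rw [Nat.cast_mul, show 2 * (j * a : ℝ) * π = 2 * a * π * j by ring,
          sqrt_mul (by positivity), mul_pow, mul_pow, ← pow_mul, mul_assoc]
    _ =Θ[atTop] fun j : ℕ => √(j : ℝ) ^ b * (j * a / exp 1) ^ (j * a * b) :=
        (isTheta_const_mul_left h_const).2 isTheta_rfl

theorem factorial_mul_pow_div_isTheta {a b : ℕ} (ha : a ≠ 0) (hb : b ≠ 0) :
    (fun j : ℕ => ((j * a)! : ℝ) ^ b / ((j * b)! : ℝ) ^ a) =Θ[atTop]
      fun j : ℕ => √(j : ℝ) ^ b / √(j : ℝ) ^ a * (a / b : ℝ) ^ (j * a * b) := by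
  refine ((factorial_mul_pow_isTheta ha b).div
    (factorial_mul_pow_isTheta hb a)).trans_eventuallyEq ?_
  filter_upwards [eventually_gt_atTop 0] with j hj
  have h_pos : (0 : ℝ) < j := Nat.cast_pos.2 hj
  rw [mul_div_mul_comm, mul_right_comm j b a, ← div_pow, div_div_div_cancel_right₀ (exp_ne_zero 1),
    mul_div_mul_left _ _ h_pos.ne']

end Asymptotics

section TuranSubsequence

variable {k j : ℕ}

theorem nSeq_eq_left (k j : ℕ) : nSeq k j = (k + 1) * (j * (k + 2)) := by
  unfold nSeq
  ring

theorem nSeq_eq_right (k j : ℕ) : nSeq k j = (k + 1 + 1) * (j * (k + 1)) := by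
  unfold nSeq
  ring

theorem tendsto_nSeq_atTop (k : ℕ) : Tendsto (nSeq k) atTop atTop :=
  (tendsto_id.atTop_mul_const' k.succ_pos).atTop_mul_const' (k + 1).succ_pos

theorem nu_nSeq_vertex (hj : j ≠ 0) :
    nu (nSeq k j) (vertex k) = turanCount (nSeq k j) (k + 1) := by
  rw [nSeq_eq_left]
  exact nu_vertex (by positivity)

theorem nu_nSeq_vertex_succ (hj : j ≠ 0) :
    nu (nSeq k j) (vertex (k + 1)) = turanCount (nSeq k j) (k + 2) := by
  rw [nSeq_eq_right]
  exact nu_vertex (by positivity)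

theorem turanCount_nSeq (hj : j ≠ 0) :
    (turanCount (nSeq k j) (k + 1) : ℝ) =
      (nSeq k j)! / ((k + 1)! * ((j * (k + 2))! : ℝ) ^ (k + 1)) := by
  rw [nSeq_eq_left]
  exact turanCount_eq_div (by positivity)

theorem turanCount_nSeq_succ (hj : j ≠ 0) :
    (turanCount (nSeq k j) (k + 2) : ℝ) =
      (nSeq k j)! / ((k + 2)! * ((j * (k + 1))! : ℝ) ^ (k + 2)) := by
  rw [nSeq_eq_right]
  exact turanCount_eq_div (by positivity)

theorem nu_nSeq_vertex_pos (hj : j ≠ 0) : 0 < nu (nSeq k j) (vertex k) := by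
  rw [nu_nSeq_vertex hj, nSeq_eq_left]
  exact turanCount_pos (by positivity)

theorem nu_nSeq_vertex_succ_pos (hj : j ≠ 0) : 0 < nu (nSeq k j) (vertex (k + 1)) := by
  rw [nu_nSeq_vertex_succ hj, nSeq_eq_right]
  exact turanCount_pos (by positivity)

theorem nu_nSeq_ratio_eq (hj : j ≠ 0) :
    (nu (nSeq k j) (vertex (k + 1)) : ℝ) / nu (nSeq k j) (vertex k) =
      (k + 2 : ℝ)⁻¹ * (((j * (k + 2))! : ℝ) ^ (k + 1) / ((j * (k + 1))! : ℝ) ^ (k + 2)) := by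
  rw [nu_nSeq_vertex hj, nu_nSeq_vertex_succ hj, turanCount_nSeq hj, turanCount_nSeq_succ hj,
    Nat.factorial_succ (k + 1)]
  push_cast
  field_simp
  ring

theorem sqrt_pow_div_isTheta_sqrt_one_div_nSeq (k : ℕ) :
    (fun j : ℕ => √(j : ℝ) ^ (k + 1) / √(j : ℝ) ^ (k + 2)) =Θ[atTop]
      fun j : ℕ => √(1 / (nSeq k j : ℝ)) := by
  have h_const : √((k + 1 : ℝ) * (k + 2)) ≠ 0 := by positivity
  refine EventuallyEq.trans_isTheta ?_ ((isTheta_const_mul_left h_const).2 isTheta_rfl)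
  filter_upwards [eventually_ne_atTop 0] with j hj
  have h_sqrt : √(nSeq k j : ℝ) = √((k + 1 : ℝ) * (k + 2)) * √(j : ℝ) := by
    rw [← sqrt_mul (by positivity), nSeq]
    push_cast
    ring_nf
  rw [one_div, sqrt_inv, h_sqrt]
  field_simp
  ring

theorem nu_nSeq_ratio_isTheta (k : ℕ) :
    (fun j : ℕ => (nu (nSeq k j) (vertex (k + 1)) : ℝ) / nu (nSeq k j) (vertex k)) =Θ[atTop]
      fun j : ℕ => √(1 / (nSeq k j : ℝ)) * ((k + 2 : ℝ) / (k + 1)) ^ nSeq k j := by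
  have h_const : (k + 2 : ℝ)⁻¹ ≠ 0 := by positivity
  calc (fun j : ℕ => (nu (nSeq k j) (vertex (k + 1)) : ℝ) / nu (nSeq k j) (vertex k))
    _ =ᶠ[atTop] fun j : ℕ =>
        (k + 2 : ℝ)⁻¹ * (((j * (k + 2))! : ℝ) ^ (k + 1) / ((j * (k + 1))! : ℝ) ^ (k + 2)) :=
      (eventually_ne_atTop 0).mono fun _ => nu_nSeq_ratio_eq
    _ =Θ[atTop] fun j : ℕ => ((j * (k + 2))! : ℝ) ^ (k + 1) / ((j * (k + 1))! : ℝ) ^ (k + 2) :=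
      (isTheta_const_mul_left h_const).2 isTheta_rfl
    _ =Θ[atTop] fun j : ℕ => √(j : ℝ) ^ (k + 1) / √(j : ℝ) ^ (k + 2) *
        ((k + 2 : ℕ) / (k + 1 : ℕ) : ℝ) ^ (j * (k + 2) * (k + 1)) :=
      factorial_mul_pow_div_isTheta (k + 1).succ_ne_zero k.succ_ne_zero
    _ =Θ[atTop] fun j : ℕ => √(1 / (nSeq k j : ℝ)) * ((k + 2 : ℝ) / (k + 1)) ^ nSeq k j := by
      have h_nSeq (j : ℕ) : j * (k + 2) * (k + 1) = nSeq k j := mul_right_comm _ _ _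
      simp only [h_nSeq, Nat.cast_add, Nat.cast_ofNat, Nat.cast_one]
      exact (sqrt_pow_div_isTheta_sqrt_one_div_nSeq k).mul isTheta_rfl

end TuranSubsequence

section Rate

variable (k : ℕ) (β : EuclideanSpace ℝ (Fin 2))

theorem vertex_apply_zero_lt_succ : vertex k 0 < vertex (k + 1) 0 := by
  simp only [vertex, Nat.cast_add, Nat.cast_one, Matrix.cons_val_zero]
  rw [div_lt_div_iff₀ (by positivity) (by positivity)]
  linarith

theorem norm_vertex_sub_pos : 0 < ‖vertex (k + 1) - vertex k‖ :=
  norm_pos_iff.2 <| sub_ne_zero.2 fun h =>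
    (vertex_apply_zero_lt_succ k).ne' (congrArg (fun x => x 0) h)

theorem inner_vertex_sub_unitDir :
    inner ℝ (vertex (k + 1) - vertex k) (unitDir k) = ‖vertex (k + 1) - vertex k‖ := by
  have h_pos := norm_vertex_sub_pos k
  rw [unitDir, real_inner_smul_right, real_inner_self_eq_norm_sq]
  field_simp

theorem rate_eq_inner_unitDir_mul_norm :
    rate k β = inner ℝ (unitDir k) β * ‖vertex (k + 1) - vertex k‖ := by
  rw [rate, inner_vertex_sub_unitDir]

theorem rate_nonneg_iff : 0 ≤ rate k β ↔ 0 ≤ inner ℝ (unitDir k) β := by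
  rw [rate_eq_inner_unitDir_mul_norm, mul_nonneg_iff_of_pos_right (norm_vertex_sub_pos k)]

theorem rate_neg_iff : rate k β < 0 ↔ inner ℝ (unitDir k) β < 0 :=
  lt_iff_lt_of_le_iff_le (rate_nonneg_iff k β)

theorem rate_eq_inner_sub_inner :
    rate k β = inner ℝ (vertex (k + 1)) β - inner ℝ (vertex k) β := by
  rw [rate_eq_inner_unitDir_mul_norm, unitDir, real_inner_smul_left, ← inner_sub_left, mul_comm,
    mul_inv_cancel_left₀ (norm_vertex_sub_pos k).ne']

end Rate

section ProbRatio

variable {k : ℕ} {β : EuclideanSpace ℝ (Fin 2)}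

theorem twoPointProb_div_twoPointProb {n : ℕ} (hn : 0 < nu n (vertex k)) :
    twoPointProb n k β (vertex (k + 1)) / twoPointProb n k β (vertex k) =
      exp ((n : ℝ) ^ 2 * rate k β) * (nu n (vertex (k + 1)) / nu n (vertex k)) := by
  rw [twoPointProb, twoPointProb, if_pos (.inr rfl), if_pos (.inl rfl),
    div_div_div_cancel_right₀ (by positivity), mul_div_mul_comm, ← exp_sub, ← mul_sub,
    rate_eq_inner_sub_inner]

theorem probRatio_eq {j : ℕ} (hj : j ≠ 0) :
    probRatio k β j = exp ((nSeq k j : ℝ) ^ 2 * rate k β) *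
      (nu (nSeq k j) (vertex (k + 1)) / nu (nSeq k j) (vertex k)) :=
  twoPointProb_div_twoPointProb (nu_nSeq_vertex_pos hj)

theorem probRatio_pos {j : ℕ} (hj : j ≠ 0) : 0 < probRatio k β j := by
  have h_left := nu_nSeq_vertex_pos (k := k) hj
  have h_right := nu_nSeq_vertex_succ_pos (k := k) hj
  rw [probRatio_eq hj]
  positivity

variable (k β)

theorem probRatio_isTheta :
    probRatio k β =Θ[atTop] fun j : ℕ => exp ((nSeq k j : ℝ) ^ 2 * rate k β) *
      √(1 / (nSeq k j : ℝ)) * ((k + 2 : ℝ) / (k + 1)) ^ nSeq k j := by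
  simp only [mul_assoc]
  exact EventuallyEq.trans_isTheta ((eventually_ne_atTop 0).mono fun _ => probRatio_eq)
    (isTheta_rfl.mul (nu_nSeq_ratio_isTheta k))

theorem tendsto_nSeq_sq_atTop : Tendsto (fun j => (nSeq k j : ℝ) ^ 2) atTop atTop :=
  (tendsto_pow_atTop two_ne_zero).comp (tendsto_natCast_atTop_atTop.comp (tendsto_nSeq_atTop k))

theorem tendsto_log_probRatio :
    Tendsto (fun j : ℕ => log (probRatio k β j) / (nSeq k j : ℝ) ^ 2) atTop (𝓝 (rate k β)) :=
  tendsto_log_div_of_isTheta (probRatio_isTheta k β) (tendsto_nSeq_sq_atTop k)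
    ((tendsto_log_exp_sq_mul_sqrt_mul_pow (rate k β) (by positivity)).comp (tendsto_nSeq_atTop k))

variable {k β}

theorem tendsto_probRatio_nhds_zero (h : rate k β < 0) : Tendsto (probRatio k β) atTop (𝓝 0) :=
  tendsto_zero_of_tendsto_log_div h (tendsto_nSeq_sq_atTop k) (tendsto_log_probRatio k β)

theorem tendsto_probRatio_atTop (h : 0 ≤ rate k β) : Tendsto (probRatio k β) atTop atTop := by
  have hq : 1 < (k + 2 : ℝ) / (k + 1) := by
    rw [one_lt_div (by positivity)]
    linarith
  have h_norm : Tendsto (norm ∘ probRatio k β) atTop atTop :=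
    (probRatio_isTheta k β).tendsto_norm_atTop_iff.2 <| tendsto_norm_atTop_atTop.comp <|
      (tendsto_exp_sq_mul_sqrt_mul_pow_atTop h hq).comp (tendsto_nSeq_atTop k)
  exact h_norm.congr' <| (eventually_ne_atTop 0).mono fun _ hj =>
    norm_of_nonneg (probRatio_pos hj).le

end ProbRatio

end EdgeTriangle

theorem mainTheorem5 (k : ℕ) (hk : 1 ≤ k) (β : EuclideanSpace ℝ (Fin 2)) :
    -- the limit of the ratio
    (0 ≤ inner ℝ (EdgeTriangle.unitDir k) β →
      Tendsto (EdgeTriangle.probRatio k β) atTop atTop) ∧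
    (inner ℝ (EdgeTriangle.unitDir k) β < 0 →
      Tendsto (EdgeTriangle.probRatio k β) atTop (𝓝 0)) ∧
    -- the rate: exponential in `n²`, with a constant of the same sign as `⟨l_k, β⟩`
    0 < inner ℝ (EdgeTriangle.vertex (k + 1) - EdgeTriangle.vertex k) (EdgeTriangle.unitDir k) ∧
    Tendsto (fun j : ℕ => Real.log (EdgeTriangle.probRatio k β j) /
        (EdgeTriangle.nSeq k j : ℝ) ^ 2) atTop (𝓝 (EdgeTriangle.rate k β)) ∧
    (EdgeTriangle.probRatio k β =Θ[atTop] fun j : ℕ =>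
      Real.exp ((EdgeTriangle.nSeq k j : ℝ) ^ 2 * EdgeTriangle.rate k β) *
        Real.sqrt (1 / (EdgeTriangle.nSeq k j : ℝ)) *
        (((k : ℝ) + 2) / ((k : ℝ) + 1)) ^ EdgeTriangle.nSeq k j) ∧
    -- the count of labeled balanced Turán graphs
    (∀ j : ℕ, 1 ≤ j →
      EdgeTriangle.nu (EdgeTriangle.nSeq k j) (EdgeTriangle.vertex k) =
          EdgeTriangle.turanCount (EdgeTriangle.nSeq k j) (k + 1) ∧
      EdgeTriangle.nu (EdgeTriangle.nSeq k j) (EdgeTriangle.vertex (k + 1)) =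
          EdgeTriangle.turanCount (EdgeTriangle.nSeq k j) (k + 2) ∧
      (EdgeTriangle.turanCount (EdgeTriangle.nSeq k j) (k + 1) : ℝ) =
          ((EdgeTriangle.nSeq k j).factorial : ℝ) /
            (((k + 1).factorial : ℝ) * ((j * (k + 2)).factorial : ℝ) ^ (k + 1)) ∧
      (EdgeTriangle.turanCount (EdgeTriangle.nSeq k j) (k + 2) : ℝ) =
          ((EdgeTriangle.nSeq k j).factorial : ℝ) /
            (((k + 2).factorial : ℝ) * ((j * (k + 1)).factorial : ℝ) ^ (k + 2))) ∧
    ((fun j : ℕ =>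
        (EdgeTriangle.nu (EdgeTriangle.nSeq k j) (EdgeTriangle.vertex (k + 1)) : ℝ) /
          (EdgeTriangle.nu (EdgeTriangle.nSeq k j) (EdgeTriangle.vertex k) : ℝ)) =Θ[atTop]
      fun j : ℕ => Real.sqrt (1 / (EdgeTriangle.nSeq k j : ℝ)) *
        (((k : ℝ) + 2) / ((k : ℝ) + 1)) ^ EdgeTriangle.nSeq k j) := by
  rw [← EdgeTriangle.rate_nonneg_iff k β, ← EdgeTriangle.rate_neg_iff k β,
    EdgeTriangle.inner_vertex_sub_unitDir]
  refine ⟨EdgeTriangle.tendsto_probRatio_atTop, EdgeTriangle.tendsto_probRatio_nhds_zero,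
    EdgeTriangle.norm_vertex_sub_pos k, EdgeTriangle.tendsto_log_probRatio k β,
    EdgeTriangle.probRatio_isTheta k β, fun j hj => ?_, EdgeTriangle.nu_nSeq_ratio_isTheta k⟩
  have hj₀ : j ≠ 0 := Nat.one_le_iff_ne_zero.1 hj
  exact ⟨EdgeTriangle.nu_nSeq_vertex hj₀, EdgeTriangle.nu_nSeq_vertex_succ hj₀,
    EdgeTriangle.turanCount_nSeq hj₀, EdgeTriangle.turanCount_nSeq_succ hj₀⟩
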